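/- Let $\mathcal H=\mathbb C^n$ be a finite-dimensional single-particle space with standard orthonormal basis, let $c_i^\dagger,c_i$ ($1\le i\le n$) be the corresponding fermionic creation and annihilation operators on the antisymmetric Fock space $\mathcal F$ over $\mathcal H$, and put $c_\varphi^\dagger=\sum_i\varphi_i c_i^\dagger$, $c_\varphi=(c_\varphi^\dagger)^\dagger$ for $\varphi\in\mathcal H$. For an operator $\rho$ on $\mathcal F$ let $\rho^{(1)}$ be the $n\times n$ matrix $\rho^{(1)}_{ij}=\mathrm{Tr}(\rho\,c_j^\dagger c_i)$ (the single-particle density matrix). For a Hermitian $n\times n$ matrix $A$ let $\boldsymbol\lambda(A)\in\mathbb R^n$ be its vector of eigenvalues, with multiplicity, in decreasing order. For decreasingly ordered $x,y\in\mathbb R^n$ write $x\prec y$ if $\sum_{\nu\le m}x_\nu\le\sum_{\nu\le m}y_\nu$ for all $m<n$, with equality for $m=n$. A quantum operation on $\mathcal F$ is one-body-entanglement nongenerating if it can be written as $\varepsilon(\rho)=\sum_j K_j\rho K_j^\dagger$ with finitely many operators $K_j$ commuting with the fermion number $\hat N=\sum_i c_i^\dagger c_i$ and satisfying $\sum_jK_j^\dagger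 K_j=\mathbb 1$, such that for every density operator $\rho$ on $\mathcal F$, $$\boldsymbol\lambda(\rho^{(1)})\prec\sum_j p_j\,\boldsymbol\lambda(\rho_j^{(1)}),\qquad p_j=\mathrm{Tr}(\rho K_j^\dagger K_j),\quad \rho_j=K_j\rho K_j^\dagger/p_j ,$$ where terms with $p_j=0$ are zero. Theorem. Let $|k\rangle\in\mathcal H$ be a unit vector, $P_k=c_k^\dagger c_k$ and $P_{\bar k}=c_kc_k^\dagger$. Then the measurement of the occupancy of $|k\rangle$, $\varepsilon(\rho)=P_k\rho P_k+P_{\bar k}\rho P_{\bar k}$, is one-body-entanglement nongenerating, and the Kraus operators $P_k,P_{\bar k}$ themselves have the required properties. That is, for every density operator $\rho$ on $\mathcal F$, pure or mixed (in particular for every mixed state that commutes with the number $\hat N$ or with the parity $e^{i\pi\hat N}$), with $p_k=\mathrm{Tr}(\rho P_k)=1-p_{\bar k}$, $\rho_k=P_k\rho P_k/p_k$ and $\rho_{\bar k}=P_{\bar k}\rho P_{\bar k}/p_{\bar k}$, $$\boldsymbol\lambda(\rho^{(1)})\prec p_k\,\boldsymbol\lambda(\rho_k^{(1)})+p_{\bar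 k}\,\boldsymbol\lambda(\rho_{\bar k}^{(1)}).$$ Moreover, for every subspace $\mathcal S\subseteq\mathcal H$ that contains $|k\rangle$ or is orthogonal to $|k\rangle$, with orthogonal projector $P_{\mathcal S}$ and restrictions $\sigma^{(1)}_{\mathcal S}=P_{\mathcal S}\,\sigma^{(1)}P_{\mathcal S}$, and for every density operator $\rho$ on $\mathcal F$, $$\boldsymbol\lambda(\rho^{(1)}_{\mathcal S})\prec p_k\,\boldsymbol\lambda(\rho^{(1)}_{k\,\mathcal S})+p_{\bar k}\,\boldsymbol\lambda(\rho^{(1)}_{\bar k\,\mathcal S}).$$ -/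

import Mathlib

open scoped Matrix ComplexOrder

namespace FermionFock

/-- Operators on the single-particle space `ℂⁿ`, written in the standard orthonormal basis. -/
abbrev SPOp (n : ℕ) := Matrix (Fin n) (Fin n) ℂ

/-- Operators on the fermionic Fock space over `ℂⁿ`, written in the occupation-number basis.
The basis vector labelled by `S = {i₁ < ⋯ < i_N}` is the Slater determinant
`c†_{i₁} ⋯ c†_{i_N} |0⟩`; the empty set labels the vacuum. -/
abbrev FockOp (n : ℕ) := Matrix (Finset (Fin n)) (Finset (Fin n)) ℂ

variable {n : ℕ}

/-- The creation operator `c†_i` of the `i`-th standard basis mode: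
`c†_i |S⟩ = (-1)^{#{j ∈ S : j < i}} |S ∪ {i}⟩` if `i ∉ S`, and `c†_i |S⟩ = 0` if `i ∈ S`. -/
def create (i : Fin n) : FockOp n :=
  Matrix.of fun T S =>
    if i ∉ S ∧ T = insert i S then (-1 : ℂ) ^ (S.filter (fun j => j < i)).card else 0

/-- The annihilation operator `c_i = (c†_i)†`. -/
def annihilate (i : Fin n) : FockOp n := (create i)ᴴ

/-- The creation operator `c†_φ = ∑ᵢ φᵢ c†_i` of a single-particle state `φ ∈ ℂⁿ`. -/
noncomputable def createMode (φ : EuclideanSpace ℂ (Fin n)) : FockOp n :=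
  ∑ i, φ i • create i

/-- The annihilation operator `c_φ = (c†_φ)† = ∑ᵢ (φᵢ)^* c_i`. -/
noncomputable def annihilateMode (φ : EuclideanSpace ℂ (Fin n)) : FockOp n :=
  (createMode φ)ᴴ

/-- The fermion number operator `∑ᵢ c†_i c_i`. -/
def numberOp (n : ℕ) : FockOp n := ∑ i, create i * annihilate i

/-- `P_k = c†_k c_k`: the mode `k` is found occupied. -/
noncomputable def occupiedOp (k : EuclideanSpace ℂ (Fin n)) : FockOp n :=
  createMode k * annihilateMode k

/-- `P_k̄ = c_k c†_k`: the mode `k` is found empty. -/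
noncomputable def emptyOp (k : EuclideanSpace ℂ (Fin n)) : FockOp n :=
  annihilateMode k * createMode k

/-- Density operators on the Fock space (pure or mixed states). -/
structure IsDensity (ρ : FockOp n) : Prop where
  posSemidef : ρ.PosSemidef
  trace_eq_one : ρ.trace = 1

/-- The single-particle density matrix `ρ⁽¹⁾_{ij} = Tr (ρ c†_j c_i)`. -/
def spdm (ρ : FockOp n) : SPOp n :=
  Matrix.of fun i j => (ρ * (create j * annihilate i)).trace

/-- The orthogonal projector `P_S` onto a subspace `S` of the single-particle space. -/
noncomputable def subspaceProj (S : Submodule ℂ (EuclideanSpace ℂ (Fin n))) : SPOp n :=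
  Matrix.toEuclideanLin.symm (S.starProjection : _ →ₗ[ℂ] EuclideanSpace ℂ (Fin n))

/-- The restriction `P_S ρ⁽¹⁾ P_S` of the single-particle density matrix to `S`. -/
noncomputable def spdmOn (S : Submodule ℂ (EuclideanSpace ℂ (Fin n))) (ρ : FockOp n) : SPOp n :=
  subspaceProj S * spdm ρ * subspaceProj S

/-- The probability `Tr (ρ K† K)` of the outcome with Kraus operator `K`. -/
def outcomeProb (K ρ : FockOp n) : ℝ := ((ρ * (Kᴴ * K)).trace).re

/-- The postmeasurement state `K ρ K† / Tr (ρ K† K)`. If the outcome has probability zero this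
is the zero matrix, and it only occurs with weight zero below. -/
noncomputable def postState (K ρ : FockOp n) : FockOp n :=
  (((outcomeProb K ρ)⁻¹ : ℝ) : ℂ) • (K * ρ * Kᴴ)

open Classical in
/-- The eigenvalues of a Hermitian matrix, with multiplicity, in decreasing order.
(Only used for Hermitian matrices, see the lemmas below.) -/
noncomputable def sortedSpectrum (A : SPOp n) : Fin n → ℝ := fun i =>
  if h : A.IsHermitian then h.eigenvalues₀ (Fin.cast (Fintype.card_fin n).symm i) else 0

/-- Majorization `x ≺ y` of real vectors sorted in decreasing order. -/
structure Majorized (x y : Fin n → ℝ) : Prop where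
  antitone_left : Antitone x
  antitone_right : Antitone y
  sum_le : ∀ m : ℕ, m < n →
    ∑ i : Fin n with i.val < m, x i ≤ ∑ i : Fin n with i.val < m, y i
  sum_eq : ∑ i, x i = ∑ i, y i

/-- The quantum operation `ρ ↦ ∑ⱼ Kⱼ ρ Kⱼ†` with Kraus operators `Kⱼ`. -/
def krausMap {r : ℕ} (K : Fin r → FockOp n) (ρ : FockOp n) : FockOp n :=
  ∑ j, K j * ρ * (K j)ᴴ

/-- A finite family of number-conserving Kraus operators `Kⱼ` with `∑ⱼ Kⱼ† Kⱼ = 1`, such that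
`λ(ρ⁽¹⁾) ≺ ∑ⱼ pⱼ λ(ρⱼ⁽¹⁾)` for every state `ρ`, where `pⱼ` are the probabilities of the
outcomes and `ρⱼ` the postmeasurement states. -/
structure IsNongeneratingFamily {r : ℕ} (K : Fin r → FockOp n) : Prop where
  complete : ∑ j, (K j)ᴴ * K j = 1
  number_conserving : ∀ j, Commute (K j) (numberOp n)
  majorized : ∀ ρ : FockOp n, IsDensity ρ →
    Majorized (sortedSpectrum (spdm ρ))
      (∑ j, outcomeProb (K j) ρ • sortedSpectrum (spdm (postState (K j) ρ)))

/-- A quantum operation is one-body-entanglement nongenerating if it admits a set of Kraus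
operators as in `IsNongeneratingFamily`. -/
def IsONG (ε : FockOp n → FockOp n) : Prop :=
  ∃ (r : ℕ) (K : Fin r → FockOp n), ε = krausMap K ∧ IsNongeneratingFamily K

/-- The Kraus operators `P_k`, `P_k̄` of the measurement of the occupancy of the mode `k`. -/
noncomputable def occupancyKraus (k : EuclideanSpace ℂ (Fin n)) : Fin 2 → FockOp n :=
  ![occupiedOp k, emptyOp k]

/-! The matrices to which `sortedSpectrum` is applied are Hermitian. -/

theorem isHermitian_spdm {ρ : FockOp n} (hρ : ρ.IsHermitian) : (spdm ρ).IsHermitian := by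
  ext i j
  simp only [spdm, annihilate, Matrix.conjTranspose_apply, Matrix.of_apply]
  rw [← Matrix.trace_conjTranspose, Matrix.conjTranspose_mul, Matrix.conjTranspose_mul,
    Matrix.conjTranspose_conjTranspose, hρ.eq, Matrix.trace_mul_comm]

theorem isHermitian_subspaceProj (S : Submodule ℂ (EuclideanSpace ℂ (Fin n))) :
    (subspaceProj S).IsHermitian := by
  rw [← Matrix.isSymmetric_toEuclideanLin_iff, subspaceProj, LinearEquiv.apply_symm_apply]
  exact S.starProjection_isSymmetric

theorem isHermitian_spdmOn (S : Submodule ℂ (EuclideanSpace ℂ (Fin n))) {ρ : FockOp n}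
    (hρ : ρ.IsHermitian) : (spdmOn S ρ).IsHermitian := by
  have h := Matrix.isHermitian_conjTranspose_mul_mul (subspaceProj S) (isHermitian_spdm hρ)
  rwa [(isHermitian_subspaceProj S).eq] at h

theorem isHermitian_postState (K : FockOp n) {ρ : FockOp n} (hρ : ρ.IsHermitian) :
    (postState K ρ).IsHermitian := by
  have h := Matrix.isHermitian_mul_mul_conjTranspose K hρ
  unfold postState Matrix.IsHermitian
  rw [Matrix.conjTranspose_smul, h.eq, Complex.star_def, Complex.conj_ofReal]

end FermionFock

open FermionFock

/-!
Write `n_f = c†_f c_f`, so that `⟨f|ρ⁽¹⁾|f⟩ = Tr (ρ n_f)`, and let `X`, `Y` be the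
single-particle density matrices of the unnormalized postmeasurement states `P_k ρ P_k` and
`P_k̄ ρ P_k̄`. Orthogonally to `k`, and in `k` itself, the
measurement leaves mean occupations unchanged, because there the occupation number `n_f`
commutes with `P_k` (`expVal_spdmOn_of_commute`). So `ρ⁽¹⁾` differs from `X + Y` only in the
coherences between `k` and its orthogonal complement.

By Ky Fan's principle (`sum_expVal_le`, `exists_sum_expVal_eq`) the sum of the `m` largest
eigenvalues of a Hermitian matrix is the maximum of `∑ⱼ ⟨fⱼ|A|fⱼ⟩` over orthonormal families of
length `m`. Take a maximizing family for `ρ⁽¹⁾`; rotating it inside its span, all its vectors except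
`f₀ = αk + βw` can be assumed orthogonal to `k` (`exists_orthonormal_rotation`). Then `k, f₁, …` is
a test family for `X` and `w, f₁, …` one for `Y`, and the majorization follows
(`majorized_of_expVal_superposition`) from the single inequality
`Tr (ρ n_{αk+βw}) ≤ Tr (ρ P_k) + Tr (ρ P_k̄ n_w P_k̄)`: where a superposition of two modes is
occupied, at least one of the modes is. It holds because the difference of the two operators is
`c†_{u'} (1 - n_u) c_{u'} ≥ 0`, where `u = αk + βw` and `u' = -β^*k + α^*w` is the other vector of
the rotated pair (`occupied_or_sub_eq`). The inequality persists for `‖w‖ ≤ 1`, which gives the case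
of a subspace `S` containing `k`; for `S` orthogonal to `k` there are no coherences at all and
the majorization is that of a sum of Hermitian matrices.
-/

open scoped Matrix ComplexOrder

namespace FermionFock

variable {n : ℕ}

/-! ### Creation and annihilation operators in the occupation-number basis -/

/-- The Jordan-Wigner sign `(-1)^{#{j ∈ S : j < i}}`. -/
def jwSign (i : Fin n) (S : Finset (Fin n)) : ℂ := (-1) ^ (S.filter (fun j => j < i)).card

theorem jwSign_mul_self (i : Fin n) (S : Finset (Fin n)) : jwSign i S * jwSign i S = 1 := by
  rw [jwSign, ← mul_pow]; simp

theorem jwSign_insert (i : Fin n) {j : Fin n} {S : Finset (Fin n)} (hj : j ∉ S) :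
    jwSign i (insert j S) = if j < i then -jwSign i S else jwSign i S := by
  unfold jwSign
  rw [Finset.filter_insert]
  split_ifs
  · rw [Finset.card_insert_of_notMem (by simp [hj]), pow_succ]; ring
  · rfl

theorem jwSign_erase (i : Fin n) {j : Fin n} {S : Finset (Fin n)} (hj : j ∈ S) :
    jwSign i (S.erase j) = if j < i then -jwSign i S else jwSign i S := by
  have h := jwSign_insert i (Finset.notMem_erase j S)
  rw [Finset.insert_erase hj] at h
  rw [h]
  split_ifs <;> simp

/-- The occupation-number basis vector labelled by `S`. -/
def ket (S : Finset (Fin n)) : Finset (Fin n) → ℂ := Pi.single S 1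

theorem create_mulVec_ket (i : Fin n) (S : Finset (Fin n)) :
    create i *ᵥ ket S =
      if i ∈ S then 0 else jwSign i S • ket (insert i S) := by
  ext T
  simp only [ket, Matrix.mulVec_single_one, Matrix.col_apply, create, Matrix.of_apply]
  by_cases hi : i ∈ S
  · simp [hi]
  · by_cases hT : T = insert i S <;> simp [hi, hT, jwSign]

theorem annihilate_mulVec_ket (i : Fin n) (S : Finset (Fin n)) :
    annihilate i *ᵥ ket S =
      if i ∈ S then jwSign i S • ket (S.erase i) else 0 := by
  ext T
  simp only [ket, Matrix.mulVec_single_one, Matrix.col_apply, annihilate, create,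
    Matrix.conjTranspose_apply, Matrix.of_apply]
  by_cases hi : i ∈ S
  · by_cases hT : T = S.erase i
    · subst hT
      have h := jwSign_erase i hi
      simp only [lt_irrefl, if_false] at h
      rw [jwSign, jwSign] at h
      simp [hi, Finset.insert_erase, h, jwSign]
    · have : ¬ (i ∉ T ∧ S = insert i T) := by
        rintro ⟨h1, rfl⟩
        exact hT (by simp [h1])
      simp [this, hi, hT]
  · have : ¬ (i ∉ T ∧ S = insert i T) := by
      rintro ⟨h1, rfl⟩
      simp at hi
    simp [this, hi]

theorem ext_mulVec_ket {A B : FockOp n}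
    (h : ∀ S, A *ᵥ ket S = B *ᵥ ket S) : A = B := by
  ext T S
  simpa [ket] using congrFun (h S) T

/-! ### Canonical anticommutation relations -/

/-- Canonical anticommutation relation of the creation operators of the standard basis; for
`i = j` it says that the square is its own negative. -/
theorem create_mul_create (i j : Fin n) :
    create i * create j = -(create j * create i) := by
  refine ext_mulVec_ket fun S => ?_
  rw [Matrix.neg_mulVec, ← Matrix.mulVec_mulVec, ← Matrix.mulVec_mulVec, create_mulVec_ket,
    create_mulVec_ket]
  rcases lt_trichotomy i j with h | rfl | h
  · by_cases hi : i ∈ S <;> by_cases hj : j ∈ S <;>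
      simp [hi, hj, Matrix.mulVec_smul, create_mulVec_ket, h.ne, h.ne', jwSign_insert, h, h.not_gt,
        smul_smul, Finset.insert_comm i j, mul_comm]
  · by_cases hi : i ∈ S <;> simp [hi, Matrix.mulVec_smul, create_mulVec_ket]
  · by_cases hi : i ∈ S <;> by_cases hj : j ∈ S <;>
      simp [hi, hj, Matrix.mulVec_smul, create_mulVec_ket, h.ne, h.ne', jwSign_insert, h, h.not_gt,
        smul_smul, Finset.insert_comm i j, mul_comm]

theorem annihilate_mul_create (i j : Fin n) :
    annihilate i * create j = (if i = j then 1 else 0) - create j * annihilate i := by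
  refine ext_mulVec_ket fun S => ?_
  rw [Matrix.sub_mulVec, ← Matrix.mulVec_mulVec, ← Matrix.mulVec_mulVec, create_mulVec_ket,
    annihilate_mulVec_ket]
  rcases lt_trichotomy i j with h | rfl | h
  · by_cases hi : i ∈ S <;> by_cases hj : j ∈ S <;>
      simp [hi, hj, Matrix.mulVec_smul, create_mulVec_ket, annihilate_mulVec_ket, h.ne, h.ne',
        jwSign_insert, jwSign_erase, h, h.not_gt, smul_smul, mul_comm, Finset.erase_insert_of_ne]
  · by_cases hi : i ∈ S <;>
      simp [hi, Matrix.mulVec_smul, create_mulVec_ket, annihilate_mulVec_ket, jwSign_insert,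
        jwSign_erase, smul_smul, jwSign_mul_self]
  · by_cases hi : i ∈ S <;> by_cases hj : j ∈ S <;>
      simp [hi, hj, Matrix.mulVec_smul, create_mulVec_ket, annihilate_mulVec_ket, h.ne, h.ne',
        jwSign_insert, jwSign_erase, h, h.not_gt, smul_smul, mul_comm, Finset.erase_insert_of_ne]

theorem createMode_mul_createMode (φ ψ : EuclideanSpace ℂ (Fin n)) :
    createMode φ * createMode ψ = -(createMode ψ * createMode φ) := by
  simp only [createMode, Finset.sum_mul_sum, ← Finset.sum_neg_distrib]
  rw [Finset.sum_comm]
  refine Finset.sum_congr rfl fun j _ => Finset.sum_congr rfl fun i _ => ?_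
  rw [smul_mul_smul_comm, smul_mul_smul_comm, create_mul_create, mul_comm (φ i), smul_neg]

theorem annihilateMode_eq_sum (φ : EuclideanSpace ℂ (Fin n)) :
    annihilateMode φ = ∑ i, star (φ i) • annihilate i := by
  simp [annihilateMode, createMode, annihilate, Matrix.conjTranspose_sum,
    Matrix.conjTranspose_smul]

theorem annihilateMode_mul_annihilateMode (φ ψ : EuclideanSpace ℂ (Fin n)) :
    annihilateMode φ * annihilateMode ψ = -(annihilateMode ψ * annihilateMode φ) := by
  simp only [annihilateMode, ← Matrix.conjTranspose_mul, ← Matrix.conjTranspose_neg]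
  rw [createMode_mul_createMode]

/-- The canonical anticommutation relation `c_φ c†_ψ + c†_ψ c_φ = ⟨φ, ψ⟩`. -/
theorem annihilateMode_mul_createMode (φ ψ : EuclideanSpace ℂ (Fin n)) :
    annihilateMode φ * createMode ψ =
      inner ℂ φ ψ • (1 : FockOp n) - createMode ψ * annihilateMode φ := by
  rw [annihilateMode_eq_sum, createMode, Finset.sum_mul_sum, Finset.sum_mul_sum]
  rw [Finset.sum_comm (s := Finset.univ) (t := Finset.univ) (f := fun i j => (ψ i • create i) * _)]
  simp only [smul_mul_smul_comm, annihilate_mul_create, smul_sub, Finset.sum_sub_distrib,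
    smul_ite, smul_zero, Finset.sum_ite_eq, Finset.mem_univ, if_true]
  congr 1
  · rw [← Finset.sum_smul, PiLp.inner_apply]
    simp [mul_comm]
  · simp [mul_comm]

theorem numberOp_mul_createMode (φ : EuclideanSpace ℂ (Fin n)) :
    numberOp n * createMode φ = createMode φ * numberOp n + createMode φ := by
  have h (i : Fin n) : numberOp n * create i = create i * numberOp n + create i := by
    have (j : Fin n) : create j * annihilate j * create i =
        create i * (create j * annihilate j) + if j = i then create j else 0 := by
      rw [mul_assoc, annihilate_mul_create, mul_sub, ← mul_assoc, create_mul_create]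
      split_ifs <;> simp [mul_assoc, add_comm]
    simp only [numberOp, Finset.sum_mul, this, Finset.sum_add_distrib, Finset.mul_sum]
    simp
  simp only [createMode, Finset.mul_sum, Finset.sum_mul, Matrix.mul_smul, Matrix.smul_mul, h,
    smul_add, Finset.sum_add_distrib]

theorem isHermitian_numberOp : (numberOp n).IsHermitian := by
  simp [Matrix.IsHermitian, numberOp, annihilate, Matrix.conjTranspose_sum]

theorem annihilateMode_mul_numberOp (φ : EuclideanSpace ℂ (Fin n)) :
    annihilateMode φ * numberOp n = numberOp n * annihilateMode φ + annihilateMode φ := by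
  have h := congrArg Matrix.conjTranspose (numberOp_mul_createMode φ)
  simpa [Matrix.conjTranspose_mul, isHermitian_numberOp.eq, annihilateMode] using h

/-! ### Ky Fan's principle and majorization -/

/-- The expectation value `⟨v|A|v⟩` (its real part, which is all of it for Hermitian `A`). -/
noncomputable def expVal (A : SPOp n) (v : EuclideanSpace ℂ (Fin n)) : ℝ :=
  (inner ℂ v (A.toEuclideanLin v)).re

theorem antitone_sortedSpectrum (A : SPOp n) : Antitone (sortedSpectrum A) := by
  intro i j hij
  unfold sortedSpectrum
  split_ifs with h
  · exact h.eigenvalues₀_antitone (by simpa using hij)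
  · exact le_rfl

/-- The spectral theorem, with the eigenvalues in the order of `sortedSpectrum`. -/
theorem exists_sortedSpectrum_eigenbasis {A : SPOp n} (hA : A.IsHermitian) :
    ∃ b : OrthonormalBasis (Fin n) ℂ (EuclideanSpace ℂ (Fin n)),
      ∀ i, A.toEuclideanLin (b i) = (sortedSpectrum A i : ℂ) • b i := by
  have hs := Matrix.isSymmetric_toEuclideanLin_iff.mpr hA
  refine ⟨(hs.eigenvectorBasis finrank_euclideanSpace).reindex
    (finCongr (Fintype.card_fin n)), fun i => ?_⟩
  rw [OrthonormalBasis.reindex_apply, hs.apply_eigenvectorBasis]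
  simp [sortedSpectrum, hA, Matrix.IsHermitian.eigenvalues₀]

theorem expVal_eigenvector {A : SPOp n} {v : EuclideanSpace ℂ (Fin n)} {l : ℝ} (hv : ‖v‖ = 1)
    (h : A.toEuclideanLin v = (l : ℂ) • v) : expVal A v = l := by
  rw [expVal, h, inner_smul_right, inner_self_eq_norm_sq_to_K, hv]
  simp

theorem expVal_eq_sum {A : SPOp n} {l : Fin n → ℝ}
    {b : OrthonormalBasis (Fin n) ℂ (EuclideanSpace ℂ (Fin n))}
    (hb : ∀ i, A.toEuclideanLin (b i) = (l i : ℂ) • b i) (v : EuclideanSpace ℂ (Fin n)) :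
    expVal A v = ∑ i, l i * ‖inner ℂ (b i) v‖ ^ 2 := by
  have h : A.toEuclideanLin v = ∑ i, inner ℂ (b i) v • (l i : ℂ) • b i := by
    conv_lhs => rw [← b.sum_repr' v]
    simp [map_sum, hb]
  rw [expVal, h, inner_sum, Complex.re_sum]
  refine Finset.sum_congr rfl fun i _ => ?_
  rw [inner_smul_right, inner_smul_right, ← inner_conj_symm v, mul_left_comm, RCLike.mul_conj,
    Complex.re_ofReal_mul]
  norm_cast

theorem sum_expVal_orthonormalBasis {A : SPOp n} (hA : A.IsHermitian)
    (b : OrthonormalBasis (Fin n) ℂ (EuclideanSpace ℂ (Fin n))) :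
    ∑ i, expVal A (b i) = ∑ i, sortedSpectrum A i := by
  obtain ⟨e, he⟩ := exists_sortedSpectrum_eigenbasis hA
  have h := congrArg Complex.re
    ((A.toEuclideanLin.trace_eq_sum_inner b).symm.trans (A.toEuclideanLin.trace_eq_sum_inner e))
  rw [Complex.re_sum, Complex.re_sum] at h
  exact h.trans (Finset.sum_congr rfl fun i _ => expVal_eigenvector (e.orthonormal.1 i) (he i))

/-- Among all weights `0 ≤ wᵢ ≤ 1` of total mass `m`, a decreasing sequence gets its largest
weighted sum from the indicator of the first `m` indices. -/
theorem sum_mul_le_sum_lt {l w : Fin n → ℝ} (hl : Antitone l) (h0 : ∀ i, 0 ≤ w i)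
    (h1 : ∀ i, w i ≤ 1) {m : ℕ} (hm : m < n) (hw : ∑ i, w i = m) :
    ∑ i, l i * w i ≤ ∑ i : Fin n with i.val < m, l i := by
  rw [Finset.sum_filter]
  have hcard : ∑ i : Fin n, (if i.val < m then (1 : ℝ) else 0) = m := by
    rw [Finset.sum_boole]
    rw [Fin.card_filter_val_lt, min_eq_right hm.le]
  -- Subtracting `t` makes the terms with index below `m` nonnegative and the others nonpositive.
  set t := l ⟨m, hm⟩
  have key : ∑ i, (l i - t) * w i ≤ ∑ i : Fin n, (l i - t) * (if i.val < m then 1 else 0) := by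
    refine Finset.sum_le_sum fun i _ => ?_
    split_ifs with hi
    · have : t ≤ l i := hl (Fin.mk_le_mk.2 hi.le)
      exact mul_le_mul_of_nonneg_left (h1 i) (by linarith)
    · have : l i ≤ t := hl (Fin.mk_le_mk.2 (not_lt.1 hi))
      rw [mul_zero]
      exact mul_nonpos_of_nonpos_of_nonneg (by linarith) (h0 i)
  simp only [sub_mul, Finset.sum_sub_distrib, ← Finset.mul_sum, hw, hcard] at key
  simpa using key

/-- **Ky Fan's inequality**: the expectation values of `A` in `m` orthonormal vectors add up to at
most the sum of the `m` largest eigenvalues. -/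
theorem sum_expVal_le {A : SPOp n} (hA : A.IsHermitian) {m : ℕ} (hm : m < n)
    {v : Fin m → EuclideanSpace ℂ (Fin n)} (hv : Orthonormal ℂ v) :
    ∑ j, expVal A (v j) ≤ ∑ i : Fin n with i.val < m, sortedSpectrum A i := by
  obtain ⟨b, hb⟩ := exists_sortedSpectrum_eigenbasis hA
  simp only [expVal_eq_sum hb]
  rw [Finset.sum_comm]
  simp only [← Finset.mul_sum]
  refine sum_mul_le_sum_lt (antitone_sortedSpectrum A)
    (fun i => Finset.sum_nonneg fun j _ => by positivity) (fun i => ?_) hm ?_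
  · have h := hv.sum_inner_products_le (b i) (s := Finset.univ)
    rw [b.orthonormal.1 i, one_pow] at h
    simpa only [norm_inner_symm (b i)] using h
  · rw [Finset.sum_comm]
    simp [b.sum_sq_norm_inner_right, hv.1]

/-- Equality holds in Ky Fan's inequality for some orthonormal family. -/
theorem exists_sum_expVal_eq {A : SPOp n} (hA : A.IsHermitian) {m : ℕ} (hm : m < n) :
    ∃ v : Fin m → EuclideanSpace ℂ (Fin n), Orthonormal ℂ v ∧
      ∑ j, expVal A (v j) = ∑ i : Fin n with i.val < m, sortedSpectrum A i := by
  obtain ⟨b, hb⟩ := exists_sortedSpectrum_eigenbasis hA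
  refine ⟨fun j => b (Fin.castLE hm.le j),
    b.orthonormal.comp _ (Fin.castLE_injective hm.le), ?_⟩
  simp only [fun i => expVal_eigenvector (b.orthonormal.1 i) (hb i)]
  refine Finset.sum_bij (fun j _ => Fin.castLE hm.le j) ?_ ?_ ?_ ?_
  · simp
  · intro i _ j _ h
    exact Fin.castLE_injective hm.le h
  · intro i hi
    exact ⟨⟨i.val, by simpa using hi⟩, by simp, rfl⟩
  · simp

/-- A unit vector is the `i`-th member of some orthonormal basis. -/
theorem exists_orthonormalBasis_apply_eq (i : Fin n) {k : EuclideanSpace ℂ (Fin n)}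
    (hk : ‖k‖ = 1) :
    ∃ b : OrthonormalBasis (Fin n) ℂ (EuclideanSpace ℂ (Fin n)), b i = k := by
  have ho : Orthonormal ℂ (Set.domRestrict {i} (fun _ => k)) :=
    ⟨fun _ => hk, fun i j hij => absurd (Subsingleton.elim i j) hij⟩
  obtain ⟨b, hb⟩ := ho.exists_orthonormalBasis_extension_of_card_eq (by simp)
  exact ⟨b, hb _ rfl⟩

/-- An orthonormal family can be rotated inside its span, which changes none of the sums
`∑ⱼ ⟨vⱼ|A|vⱼ⟩`, so that all its vectors but the first are orthogonal to a given vector `k`. -/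
theorem exists_orthonormal_rotation {m : ℕ} {v : Fin (m + 1) → EuclideanSpace ℂ (Fin n)}
    (hv : Orthonormal ℂ v) (k : EuclideanSpace ℂ (Fin n)) :
    ∃ f : Fin (m + 1) → EuclideanSpace ℂ (Fin n), Orthonormal ℂ f ∧
      (∀ j : Fin m, inner ℂ k (f j.succ) = 0) ∧
      ∀ A : SPOp n, ∑ j, expVal A (f j) = ∑ j, expVal A (v j) := by
  -- Work with coordinates `x ↦ ∑ⱼ xⱼ vⱼ` on the span; `a` represents the functional `⟨k|·⟩`.
  let F := EuclideanSpace ℂ (Fin (m + 1))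
  let e : OrthonormalBasis (Fin (m + 1)) ℂ F := EuclideanSpace.basisFun _ ℂ
  let ι : F →ₗ[ℂ] EuclideanSpace ℂ (Fin n) := e.toBasis.constr ℂ v
  have hι (j) : ι (e j) = v j := by
    rw [← e.coe_toBasis, Module.Basis.constr_basis]
  let L : F →ₗᵢ[ℂ] EuclideanSpace ℂ (Fin n) := ι.isometryOfOrthonormal (v := e.toBasis)
    (by simp) (by
      convert hv using 1
      ext1 j
      simp [hι])
  have hL (j) : L (e j) = v j := hι j
  let a : F := L.toLinearMap.adjoint k
  have ha (x : F) : inner ℂ k (L x) = inner ℂ a x :=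
    (LinearMap.adjoint_inner_left L.toLinearMap x k).symm
  obtain ⟨b, hb⟩ : ∃ b : OrthonormalBasis (Fin (m + 1)) ℂ F,
      ∀ j : Fin m, inner ℂ a (b j.succ) = 0 := by
    by_cases h0 : a = 0
    · exact ⟨e, by simp [h0]⟩
    · have hn : ‖a‖ ≠ 0 := norm_ne_zero_iff.2 h0
      obtain ⟨b, hb⟩ := exists_orthonormalBasis_apply_eq 0
        (k := ((‖a‖⁻¹ : ℝ) : ℂ) • a) 
        (by rw [norm_smul, Complex.norm_real, norm_inv, norm_norm, inv_mul_cancel₀ hn])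
      refine ⟨b, fun j => ?_⟩
      have h : inner ℂ (b 0) (b j.succ) = 0 := b.orthonormal.2 (Fin.succ_ne_zero j).symm
      rw [hb, inner_smul_left] at h
      exact (mul_eq_zero.1 h).resolve_left (by simpa using h0)
  refine ⟨fun j => L (b j), b.orthonormal.comp_linearIsometry L, fun j => ?_, fun A => ?_⟩
  · rw [ha, hb]
  · let T : F →ₗ[ℂ] F := L.toLinearMap.adjoint ∘ₗ A.toEuclideanLin ∘ₗ L.toLinearMap
    have hT (x : F) : inner ℂ x (T x) = inner ℂ (L x) (A.toEuclideanLin (L x)) :=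
      LinearMap.adjoint_inner_right L.toLinearMap x _
    have h := congrArg Complex.re ((T.trace_eq_sum_inner b).symm.trans (T.trace_eq_sum_inner e))
    simp only [hT, Complex.re_sum, hL] at h
    exact h

/-- Majorization by Ky Fan's inequality: the partial sums of the spectrum of `A` are attained in an
orthonormal family `v`, and it suffices to bound these by orthonormal families `f`, `g` for `X`,
`Y`. Equality of the total sums follows from the expectation values in one orthonormal basis. -/
theorem majorized_of_expVal {A X Y : SPOp n} (hA : A.IsHermitian) {p q : ℝ}
    (hp : 0 ≤ p) (hq : 0 ≤ q)
    (b : OrthonormalBasis (Fin n) ℂ (EuclideanSpace ℂ (Fin n)))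
    (hX : X.IsHermitian) (hY : Y.IsHermitian)
    (hb : ∀ i, expVal A (b i) = p * expVal X (b i) + q * expVal Y (b i))
    (h : ∀ m < n, ∀ v : Fin m → EuclideanSpace ℂ (Fin n), Orthonormal ℂ v →
      ∃ f g : Fin m → EuclideanSpace ℂ (Fin n), Orthonormal ℂ f ∧ Orthonormal ℂ g ∧
        ∑ j, expVal A (v j) ≤ p * ∑ j, expVal X (f j) + q * ∑ j, expVal Y (g j)) :
    Majorized (sortedSpectrum A) (p • sortedSpectrum X + q • sortedSpectrum Y) where
  antitone_left := antitone_sortedSpectrum A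
  antitone_right _ _ hij := add_le_add
    (mul_le_mul_of_nonneg_left (antitone_sortedSpectrum X hij) hp)
    (mul_le_mul_of_nonneg_left (antitone_sortedSpectrum Y hij) hq)
  sum_le m hm := by
    obtain ⟨v, hv, hvA⟩ := exists_sum_expVal_eq hA hm
    obtain ⟨f, g, hf, hg, hfg⟩ := h m hm v hv
    simp only [Pi.add_apply, Pi.smul_apply, smul_eq_mul, Finset.sum_add_distrib,
      ← Finset.mul_sum, ← hvA]
    exact hfg.trans (add_le_add
      (mul_le_mul_of_nonneg_left (sum_expVal_le hX hm hf) hp)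
      (mul_le_mul_of_nonneg_left (sum_expVal_le hY hm hg) hq))
  sum_eq := by
    simp only [Pi.add_apply, Pi.smul_apply, smul_eq_mul, Finset.sum_add_distrib,
      ← Finset.mul_sum, ← sum_expVal_orthonormalBasis hA b, ← sum_expVal_orthonormalBasis hX b,
      ← sum_expVal_orthonormalBasis hY b, hb]

/-- Two Hermitian matrices `X`, `Y` and weights `p`, `q` majorize `A` as soon as `pX + qY` has the
expectation values of `A` orthogonally to `k` and in multiples of `k`, and the expectation
values of `A` in superpositions `αk + βw` satisfy the stated upper bound. -/
theorem majorized_of_expVal_superposition {A X Y : SPOp n} (hA : A.IsHermitian)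
    (hX : X.IsHermitian) (hY : Y.IsHermitian) {p q : ℝ} (hp : 0 ≤ p) (hq : 0 ≤ q)
    {k : EuclideanSpace ℂ (Fin n)} (hk : ‖k‖ = 1)
    (horth : ∀ f, inner ℂ k f = 0 → expVal A f = p * expVal X f + q * expVal Y f)
    (hpar : ∀ c : ℂ, expVal A (c • k) = p * expVal X (c • k) + q * expVal Y (c • k))
    (hsup : ∀ (α β : ℂ) (w : EuclideanSpace ℂ (Fin n)), ‖α‖ ^ 2 + ‖β‖ ^ 2 = 1 → ‖w‖ = 1 →
      inner ℂ k w = 0 → expVal A (α • k + β • w) ≤ p * expVal X k + q * expVal Y w) :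
    Majorized (sortedSpectrum A) (p • sortedSpectrum X + q • sortedSpectrum Y) := by
  have hn : 0 < n := by
    rcases Nat.eq_zero_or_pos n with rfl | h
    · rw [Subsingleton.elim k 0] at hk
      simp at hk
    · exact h
  set i₀ : Fin n := ⟨0, hn⟩
  obtain ⟨b, hb⟩ := exists_orthonormalBasis_apply_eq i₀ hk
  refine majorized_of_expVal hA hp hq b hX hY (fun i => ?_) fun m hm v hv => ?_
  · by_cases hi : i = i₀
    · simpa [hi, hb] using hpar 1
    · exact horth _ (hb ▸ b.orthonormal.2 (Ne.symm hi))
  -- Rotate `v` so that only its first vector overlaps with `k`.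
  rcases m with _ | m
  · exact ⟨v, v, hv, hv, by simp⟩
  obtain ⟨f, hf, hfk, hsum⟩ := exists_orthonormal_rotation hv k
  rw [← hsum A]
  have hcons (u : EuclideanSpace ℂ (Fin n)) (hu : ‖u‖ = 1)
      (huf : ∀ j : Fin m, inner ℂ u (f j.succ) = 0) :
      Orthonormal ℂ (Fin.cons u (fun j => f j.succ) : Fin (m + 1) → _) := by
    constructor
    · intro i
      refine Fin.cases ?_ (fun j => ?_) i
      · simpa using hu
      · simpa using hf.1 j.succ
    · intro i j
      refine Fin.cases ?_ (fun i' => ?_) i <;> refine Fin.cases ?_ (fun j' => ?_) j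
      · simp
      · intro _
        simpa using huf j'
      · intro _
        simpa using inner_eq_zero_symm.1 (huf i')
      · intro hij
        simpa using hf.2 hij
  have htail : ∑ j : Fin m, expVal A (f j.succ) =
      p * ∑ j : Fin m, expVal X (f j.succ) + q * ∑ j : Fin m, expVal Y (f j.succ) := by
    rw [Finset.mul_sum, Finset.mul_sum, ← Finset.sum_add_distrib]
    exact Finset.sum_congr rfl fun j _ => horth _ (hfk j)
  -- Split the first vector along `k`: `f 0 = α k + r` with `r` orthogonal to `k`.
  set α : ℂ := inner ℂ k (f 0) with hα
  set r := f 0 - α • k with hr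
  have hkk : inner ℂ k k = (1 : ℂ) := by rw [inner_self_eq_norm_sq_to_K, hk]; simp
  have hf0 : f 0 = α • k + r := by simp [hr]
  have hkr : inner ℂ k r = 0 := by
    rw [hr, inner_sub_right, inner_smul_right, hkk, ← hα]; simp
  have hrf (j : Fin m) : inner ℂ r (f j.succ) = 0 := by
    rw [hr, inner_sub_left, inner_smul_left, hfk j, hf.2 (Fin.succ_ne_zero j).symm]
    simp
  have hnorm : ‖α‖ ^ 2 + ‖r‖ ^ 2 = 1 := by
    have h := norm_add_sq_eq_norm_sq_add_norm_sq_of_inner_eq_zero (𝕜 := ℂ) (α • k) r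
      (by rw [inner_smul_left, hkr, mul_zero])
    rw [← hf0, hf.1 0, norm_smul, hk] at h
    nlinarith
  -- If `r = 0`, there is no direction `w`, but then `pX + qY` agrees with `A` on every `f j`.
  by_cases h0 : r = 0
  · refine ⟨f, f, hf, hf, le_of_eq ?_⟩
    have hf0' : f 0 = α • k := by rw [hf0, h0, add_zero]
    rw [Fin.sum_univ_succ, Fin.sum_univ_succ, Fin.sum_univ_succ, htail, hf0', hpar]
    ring
  -- Otherwise test `X` on `k, f 1, …` and `Y` on `w, f 1, …`.
  · have hr0 : ‖r‖ ≠ 0 := norm_ne_zero_iff.2 h0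
    set w := ((‖r‖⁻¹ : ℝ) : ℂ) • r with hw
    have hrw : r = (‖r‖ : ℂ) • w := by
      rw [hw, smul_smul, ← Complex.ofReal_mul, mul_inv_cancel₀ hr0]; simp
    have hwn : ‖w‖ = 1 := by simp [hw, norm_smul, hr0]
    refine ⟨Fin.cons k fun j => f j.succ, Fin.cons w fun j => f j.succ, hcons k hk hfk,
      hcons w hwn fun j => by rw [hw, inner_smul_left, hrf, mul_zero], ?_⟩
    have h := hsup α ‖r‖ w (by simpa using hnorm) hwn
      (by rw [hw, inner_smul_right, hkr, mul_zero])
    rw [← hrw, ← hf0] at h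
    simp only [Fin.sum_univ_succ, Fin.cons_zero, Fin.cons_succ, htail]
    linarith

/-! ### The measurement of an occupation number -/

theorem createMode_add (φ ψ : EuclideanSpace ℂ (Fin n)) :
    createMode (φ + ψ) = createMode φ + createMode ψ := by
  simp [createMode, add_smul, Finset.sum_add_distrib]

theorem createMode_smul (a : ℂ) (φ : EuclideanSpace ℂ (Fin n)) :
    createMode (a • φ) = a • createMode φ := by
  simp [createMode, mul_smul, Finset.smul_sum]

theorem annihilateMode_add (φ ψ : EuclideanSpace ℂ (Fin n)) :
    annihilateMode (φ + ψ) = annihilateMode φ + annihilateMode ψ := by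
  simp [annihilateMode, createMode_add]

theorem annihilateMode_smul (a : ℂ) (φ : EuclideanSpace ℂ (Fin n)) :
    annihilateMode (a • φ) = star a • annihilateMode φ := by
  simp [annihilateMode, createMode_smul]

theorem conjTranspose_createMode (φ : EuclideanSpace ℂ (Fin n)) :
    (createMode φ)ᴴ = annihilateMode φ := rfl

theorem conjTranspose_annihilateMode (φ : EuclideanSpace ℂ (Fin n)) :
    (annihilateMode φ)ᴴ = createMode φ := by
  simp [annihilateMode]

theorem createMode_mul_self (φ : EuclideanSpace ℂ (Fin n)) :
    createMode φ * createMode φ = 0 := by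
  ext S T
  exact self_eq_neg.1 (congrFun₂ (createMode_mul_createMode φ φ) S T)

theorem annihilateMode_mul_self (φ : EuclideanSpace ℂ (Fin n)) :
    annihilateMode φ * annihilateMode φ = 0 := by
  ext S T
  exact self_eq_neg.1 (congrFun₂ (annihilateMode_mul_annihilateMode φ φ) S T)

theorem isHermitian_occupiedOp (φ : EuclideanSpace ℂ (Fin n)) : (occupiedOp φ).IsHermitian := by
  simp [occupiedOp, Matrix.IsHermitian, conjTranspose_createMode, conjTranspose_annihilateMode]

theorem emptyOp_eq {k : EuclideanSpace ℂ (Fin n)} (hk : ‖k‖ = 1) :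
    emptyOp k = 1 - occupiedOp k := by
  rw [emptyOp, occupiedOp, annihilateMode_mul_createMode, inner_self_eq_norm_sq_to_K, hk]
  simp

theorem isHermitian_emptyOp (k : EuclideanSpace ℂ (Fin n)) : (emptyOp k).IsHermitian := by
  simp [emptyOp, Matrix.IsHermitian, conjTranspose_createMode, conjTranspose_annihilateMode]

theorem occupiedOp_mul_self {k : EuclideanSpace ℂ (Fin n)} (hk : ‖k‖ = 1) :
    occupiedOp k * occupiedOp k = occupiedOp k := by
  have h : annihilateMode k * createMode k = 1 - createMode k * annihilateMode k := emptyOp_eq hk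
  calc occupiedOp k * occupiedOp k
      = createMode k * (annihilateMode k * createMode k) * annihilateMode k := by
        simp only [occupiedOp, mul_assoc]
    _ = occupiedOp k - createMode k * createMode k * (annihilateMode k * annihilateMode k) := by
        rw [h]; simp only [occupiedOp]; noncomm_ring
    _ = occupiedOp k := by rw [createMode_mul_self]; simp

theorem emptyOp_mul_self {k : EuclideanSpace ℂ (Fin n)} (hk : ‖k‖ = 1) :
    emptyOp k * emptyOp k = emptyOp k := by
  simp [emptyOp_eq hk, mul_sub, sub_mul, occupiedOp_mul_self hk]

theorem commute_occupiedOp_numberOp (k : EuclideanSpace ℂ (Fin n)) :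
    Commute (occupiedOp k) (numberOp n) := by
  change createMode k * annihilateMode k * numberOp n =
    numberOp n * (createMode k * annihilateMode k)
  rw [mul_assoc, annihilateMode_mul_numberOp, ← mul_assoc (numberOp n),
    numberOp_mul_createMode]
  noncomm_ring

/-- Occupied and empty projections sum to the identity, in Kraus form. -/
theorem complete_occupancyKraus {k : EuclideanSpace ℂ (Fin n)} (hk : ‖k‖ = 1) :
    ∑ j, (occupancyKraus k j)ᴴ * occupancyKraus k j = 1 := by
  simp only [Fin.sum_univ_two, occupancyKraus, Matrix.cons_val_zero, Matrix.cons_val_one,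
    (isHermitian_occupiedOp k).eq, (isHermitian_emptyOp k).eq, occupiedOp_mul_self hk,
    emptyOp_mul_self hk]
  rw [emptyOp_eq hk, add_sub_cancel]

theorem commute_occupancyKraus_numberOp {k : EuclideanSpace ℂ (Fin n)} (hk : ‖k‖ = 1)
    (j : Fin 2) : Commute (occupancyKraus k j) (numberOp n) := by
  fin_cases j
  · exact commute_occupiedOp_numberOp k
  · change Commute (emptyOp k) _
    rw [emptyOp_eq hk]
    exact (Commute.one_left _).sub_left (commute_occupiedOp_numberOp k)

/-! ### Occupation of superpositions of two modes -/

theorem occupiedOp_smul (a : ℂ) (φ : EuclideanSpace ℂ (Fin n)) :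
    occupiedOp (a • φ) = (a * star a) • occupiedOp φ := by
  simp [occupiedOp, createMode_smul, annihilateMode_smul, smul_smul, mul_comm]

theorem occupiedOp_mul_occupiedOp_of_orthogonal {φ ψ : EuclideanSpace ℂ (Fin n)}
    (h : inner ℂ φ ψ = 0) :
    occupiedOp ψ * occupiedOp φ =
      createMode ψ * createMode φ * (annihilateMode φ * annihilateMode ψ) := by
  have h1 : annihilateMode ψ * createMode φ = -(createMode φ * annihilateMode ψ) := by
    rw [annihilateMode_mul_createMode, inner_eq_zero_symm.1 h]; simp
  calc occupiedOp ψ * occupiedOp φ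
      = createMode ψ * (annihilateMode ψ * createMode φ) * annihilateMode φ := by
        simp only [occupiedOp, mul_assoc]
    _ = createMode ψ * createMode φ * -(annihilateMode ψ * annihilateMode φ) := by
        rw [h1]; noncomm_ring
    _ = _ := by rw [annihilateMode_mul_annihilateMode ψ φ, neg_neg]

theorem commute_occupiedOp_of_orthogonal {φ ψ : EuclideanSpace ℂ (Fin n)}
    (h : inner ℂ φ ψ = 0) : Commute (occupiedOp φ) (occupiedOp ψ) := by
  change occupiedOp φ * occupiedOp ψ = _
  rw [occupiedOp_mul_occupiedOp_of_orthogonal h,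
    occupiedOp_mul_occupiedOp_of_orthogonal (inner_eq_zero_symm.1 h),
    createMode_mul_createMode, annihilateMode_mul_annihilateMode, neg_mul_neg]

/-- Write `n_f = c†_f c_f`. For orthogonal `k`, `w` with `k` a unit vector,
`u = αk + βw` and `u' = -β^*k + α^*w`, where `|α|² + |β|² = 1`, the operator `n_k + (1 - n_k) n_w (1 - n_k)` exceeds `n_u` by
`c†_{u'} (1 - c†_u c_u) c_{u'}`: the unitary rotation `(k, w) ↦ (u, u')` preserves both
`n_k + n_w` and `c_k c_w`. -/
theorem occupied_or_sub_eq {k w : EuclideanSpace ℂ (Fin n)} (hk : ‖k‖ = 1)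
    (hkw : inner ℂ k w = 0) {α β : ℂ} (hαβ : ‖α‖ ^ 2 + ‖β‖ ^ 2 = 1) :
    occupiedOp k + emptyOp k * occupiedOp w * emptyOp k - occupiedOp (α • k + β • w) =
      createMode (-star β • k + star α • w) * (1 - occupiedOp (α • k + β • w)) *
        annihilateMode (-star β • k + star α • w) := by
  have hs : α * star α + β * star β = 1 := by
    rw [Complex.star_def, Complex.mul_conj', Complex.mul_conj']
    exact_mod_cast hαβ
  set u := α • k + β • w with hu
  set u' := -star β • k + star α • w with hu'
  have hsum : occupiedOp u + occupiedOp u' = occupiedOp k + occupiedOp w := by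
    simp only [occupiedOp, hu, hu', createMode_add, annihilateMode_add, createMode_smul,
      annihilateMode_smul, star_neg, star_star, add_mul, mul_add, smul_mul_smul_comm]
    linear_combination (norm := module)
      hs • (createMode k * annihilateMode k + createMode w * annihilateMode w)
  have hann : annihilateMode u * annihilateMode u' = annihilateMode k * annihilateMode w := by
    simp only [hu, hu', annihilateMode_add, annihilateMode_smul, star_neg, star_star, add_mul,
      mul_add, smul_mul_smul_comm, annihilateMode_mul_self,
      annihilateMode_mul_annihilateMode w k]
    linear_combination (norm := module) hs • (annihilateMode k * annihilateMode w)
  have hcre : createMode u' * createMode u = createMode w * createMode k := by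
    have h := congrArg Matrix.conjTranspose hann
    simpa [conjTranspose_annihilateMode] using h
  have hempty : emptyOp k * occupiedOp w * emptyOp k =
      occupiedOp w - createMode w * createMode k * (annihilateMode k * annihilateMode w) := by
    have hc : Commute (emptyOp k) (occupiedOp w) := by
      rw [emptyOp_eq hk]
      exact (Commute.one_left _).sub_left (commute_occupiedOp_of_orthogonal hkw)
    rw [hc.eq, mul_assoc, emptyOp_mul_self hk, emptyOp_eq hk, mul_sub, mul_one,
      occupiedOp_mul_occupiedOp_of_orthogonal hkw]
  have hright : createMode u' * (1 - occupiedOp u) * annihilateMode u' =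
      occupiedOp u' - createMode u' * createMode u * (annihilateMode u * annihilateMode u') := by
    simp only [occupiedOp]; noncomm_ring
  rw [hempty, hright, hann, hcre, eq_sub_of_add_eq' hsum]
  abel

theorem re_trace_mul_conjTranspose_mul_nonneg {ρ : FockOp n} (hρ : ρ.PosSemidef) (B : FockOp n) :
    0 ≤ (ρ * (Bᴴ * B)).trace.re := by
  have h := (hρ.mul_mul_conjTranspose_same B).trace_nonneg
  rw [Matrix.trace_mul_comm, ← mul_assoc, Matrix.trace_mul_comm] at h
  exact (Complex.le_def.1 h).1

/-- In every state, a superposition `u = αk + βw` is occupied with at most the probability that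
`k` is occupied or, `k` being found empty, `w` is. -/
theorem re_trace_occupiedOp_superposition_le {ρ : FockOp n} (hρ : ρ.PosSemidef)
    {k w : EuclideanSpace ℂ (Fin n)} (hk : ‖k‖ = 1) (hw : ‖w‖ ≤ 1)
    (hkw : inner ℂ k w = 0) {α β : ℂ} (hαβ : ‖α‖ ^ 2 + ‖β‖ ^ 2 = 1) :
    (ρ * occupiedOp (α • k + β • w)).trace.re ≤
      (ρ * occupiedOp k).trace.re + (ρ * (emptyOp k * occupiedOp w * emptyOp k)).trace.re := by
  have h := occupied_or_sub_eq hk hkw hαβ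
  set u := α • k + β • w with hu
  set u' := -star β • k + star α • w
  have hun : ‖u‖ ^ 2 ≤ 1 := by
    have h := norm_add_sq_eq_norm_sq_add_norm_sq_of_inner_eq_zero (𝕜 := ℂ) (α • k) (β • w)
      (by rw [inner_smul_left, inner_smul_right, hkw]; simp)
    rw [← hu, norm_smul, norm_smul, hk] at h
    nlinarith [mul_nonneg (sq_nonneg ‖β‖) (sub_nonneg.2 hw), norm_nonneg w,
      mul_nonneg (mul_nonneg (sq_nonneg ‖β‖) (norm_nonneg w)) (sub_nonneg.2 hw)]
  have h1 : (1 : FockOp n) - occupiedOp u =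
      annihilateMode u * createMode u + ((1 - ‖u‖ ^ 2 : ℝ) : ℂ) • 1 := by
    rw [annihilateMode_mul_createMode, inner_self_eq_norm_sq_to_K, occupiedOp]
    push_cast
    rw [sub_smul, one_smul]
    simp only [Complex.coe_algebraMap]
    abel
  have h2 : createMode u' * (1 - occupiedOp u) * annihilateMode u' =
      (createMode u * annihilateMode u')ᴴ * (createMode u * annihilateMode u') +
        ((1 - ‖u‖ ^ 2 : ℝ) : ℂ) • ((annihilateMode u')ᴴ * annihilateMode u') := by
    rw [h1, Matrix.conjTranspose_mul, conjTranspose_annihilateMode, conjTranspose_createMode]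
    simp only [mul_add, add_mul, mul_assoc, Matrix.smul_mul, Matrix.mul_smul, one_mul]
  have h3 := re_trace_mul_conjTranspose_mul_nonneg hρ (createMode u * annihilateMode u')
  have h4 := re_trace_mul_conjTranspose_mul_nonneg hρ (annihilateMode u')
  have h5 := congrArg (fun M => (ρ * M).trace.re) (h.trans h2)
  simp only [mul_add, mul_sub, Matrix.trace_add, Matrix.trace_sub, Matrix.mul_smul,
    Matrix.trace_smul, Complex.add_re, Complex.sub_re, smul_eq_mul, Complex.re_ofReal_mul] at h5
  nlinarith [mul_nonneg (sub_nonneg.2 hun) h4]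

/-! ### Restricted single-particle density matrices of postmeasurement states -/

/-- The expectation values of the single-particle density matrix are mean occupations. -/
theorem expVal_spdm (ρ : FockOp n) (v : EuclideanSpace ℂ (Fin n)) :
    expVal (spdm ρ) v = (ρ * occupiedOp v).trace.re := by
  rw [expVal, Matrix.toLpLin_apply, PiLp.inner_apply, occupiedOp, annihilateMode_eq_sum,
    createMode, Finset.sum_mul_sum, Finset.sum_comm]
  simp only [Matrix.mulVec, dotProduct, spdm, Matrix.of_apply, RCLike.inner_apply,
    Finset.mul_sum, Finset.sum_mul, Matrix.trace_sum, smul_mul_smul_comm, Matrix.mul_smul,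
    Matrix.trace_smul, smul_eq_mul]
  congr 1
  refine Finset.sum_congr rfl fun i _ => Finset.sum_congr rfl fun j _ => ?_
  simp only [RCLike.star_def]
  ring

theorem toEuclideanLin_subspaceProj (S : Submodule ℂ (EuclideanSpace ℂ (Fin n)))
    (v : EuclideanSpace ℂ (Fin n)) :
    (subspaceProj S).toEuclideanLin v = S.starProjection v := by
  simp [subspaceProj]

theorem expVal_spdmOn (S : Submodule ℂ (EuclideanSpace ℂ (Fin n))) (ρ : FockOp n)
    (v : EuclideanSpace ℂ (Fin n)) :
    expVal (spdmOn S ρ) v = (ρ * occupiedOp (S.starProjection v)).trace.re := by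
  rw [← expVal_spdm, expVal, expVal]
  have h : (spdmOn S ρ).toEuclideanLin v =
      S.starProjection ((spdm ρ).toEuclideanLin (S.starProjection v)) := by
    rw [← toEuclideanLin_subspaceProj, ← toEuclideanLin_subspaceProj]
    simp [spdmOn, Matrix.toLpLin_apply, Matrix.mulVec_mulVec]
  rw [h, ← Submodule.inner_starProjection_left_eq_right]

theorem outcomeProb_nonneg {ρ : FockOp n} (hρ : ρ.PosSemidef) (K : FockOp n) :
    0 ≤ outcomeProb K ρ :=
  re_trace_mul_conjTranspose_mul_nonneg hρ K

/-- Weighting by the outcome probability undoes the normalization of the postmeasurement state;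
this includes outcomes of probability zero, since then `KρK† = 0`. -/
theorem outcomeProb_smul_postState {ρ : FockOp n} (hρ : ρ.PosSemidef) (K : FockOp n) :
    (outcomeProb K ρ : ℂ) • postState K ρ = K * ρ * Kᴴ := by
  rw [postState, smul_smul, ← Complex.ofReal_mul]
  by_cases h : outcomeProb K ρ = 0
  · have hpos := hρ.mul_mul_conjTranspose_same K
    have htr : (K * ρ * Kᴴ).trace = 0 := by
      refine Complex.ext ?_ (Complex.le_def.1 hpos.trace_nonneg).2.symm
      rw [Complex.zero_re, ← h, outcomeProb, Matrix.trace_mul_comm, ← mul_assoc,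
        Matrix.trace_mul_comm]
    rw [hpos.trace_eq_zero_iff.1 htr, smul_zero]
  · rw [mul_inv_cancel₀ h]
    simp

theorem outcomeProb_mul_expVal {ρ : FockOp n} (hρ : ρ.PosSemidef) (K : FockOp n)
    (S : Submodule ℂ (EuclideanSpace ℂ (Fin n))) (v : EuclideanSpace ℂ (Fin n)) :
    outcomeProb K ρ * expVal (spdmOn S (postState K ρ)) v =
      (ρ * (Kᴴ * occupiedOp (S.starProjection v) * K)).trace.re := by
  rw [expVal_spdmOn, ← Complex.re_ofReal_mul, ← smul_eq_mul, ← Matrix.trace_smul,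
    ← Matrix.smul_mul, outcomeProb_smul_postState hρ]
  simp only [mul_assoc]
  rw [Matrix.trace_mul_comm]
  simp only [mul_assoc]

/-- The measurement of `k` does not disturb the occupation of modes whose occupation number
commutes with `P_k`. -/
theorem expVal_spdmOn_of_commute {ρ : FockOp n} (hρ : ρ.PosSemidef)
    {k : EuclideanSpace ℂ (Fin n)} (hk : ‖k‖ = 1) (S : Submodule ℂ (EuclideanSpace ℂ (Fin n)))
    {v : EuclideanSpace ℂ (Fin n)}
    (h : Commute (occupiedOp k) (occupiedOp (S.starProjection v))) :
    expVal (spdmOn S ρ) v =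
      outcomeProb (occupiedOp k) ρ * expVal (spdmOn S (postState (occupiedOp k) ρ)) v +
        outcomeProb (emptyOp k) ρ * expVal (spdmOn S (postState (emptyOp k) ρ)) v := by
  have h' : Commute (emptyOp k) (occupiedOp (S.starProjection v)) := by
    rw [emptyOp_eq hk]
    exact (Commute.one_left _).sub_left h
  rw [outcomeProb_mul_expVal hρ, outcomeProb_mul_expVal hρ, expVal_spdmOn, ← Complex.add_re,
    ← Matrix.trace_add, ← mul_add, (isHermitian_occupiedOp k).eq, (isHermitian_emptyOp k).eq,
    h.eq, h'.eq, mul_assoc (occupiedOp _), mul_assoc (occupiedOp _), occupiedOp_mul_self hk,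
    emptyOp_mul_self hk, ← mul_add, emptyOp_eq hk, add_sub_cancel, mul_one]

theorem inner_starProjection_eq_zero {k : EuclideanSpace ℂ (Fin n)}
    {S : Submodule ℂ (EuclideanSpace ℂ (Fin n))} (hS : k ∈ S) {f : EuclideanSpace ℂ (Fin n)}
    (h : inner ℂ k f = 0) : inner ℂ k (S.starProjection f) = 0 := by
  rw [← Submodule.inner_starProjection_left_eq_right, Submodule.starProjection_eq_self_iff.2 hS, h]

/-- The majorization for `S` containing `k`; `S = ⊤` is the unrestricted case. Vectors `w` are
only projected into `S`, which is why the occupation bound is needed for `‖w‖ ≤ 1`. -/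
theorem majorized_spdmOn_of_mem {ρ : FockOp n} (hρ : ρ.PosSemidef)
    {k : EuclideanSpace ℂ (Fin n)} (hk : ‖k‖ = 1) {S : Submodule ℂ (EuclideanSpace ℂ (Fin n))}
    (hS : k ∈ S) :
    Majorized (sortedSpectrum (spdmOn S ρ))
      (outcomeProb (occupiedOp k) ρ • sortedSpectrum (spdmOn S (postState (occupiedOp k) ρ)) +
        outcomeProb (emptyOp k) ρ • sortedSpectrum (spdmOn S (postState (emptyOp k) ρ))) := by
  have hSk : S.starProjection k = k := Submodule.starProjection_eq_self_iff.2 hS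
  refine majorized_of_expVal_superposition (isHermitian_spdmOn S hρ.isHermitian)
    (isHermitian_spdmOn S (isHermitian_postState _ hρ.isHermitian))
    (isHermitian_spdmOn S (isHermitian_postState _ hρ.isHermitian))
    (outcomeProb_nonneg hρ _) (outcomeProb_nonneg hρ _) hk (fun f hf => ?_) (fun c => ?_)
    fun α β w hαβ hw hkw => ?_
  · exact expVal_spdmOn_of_commute hρ hk S
      (commute_occupiedOp_of_orthogonal (inner_starProjection_eq_zero hS hf))
  · refine expVal_spdmOn_of_commute hρ hk S ?_
    rw [map_smul, hSk, occupiedOp_smul]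
    exact (Commute.refl _).smul_right _
  · rw [outcomeProb_mul_expVal hρ, outcomeProb_mul_expVal hρ, expVal_spdmOn, map_add, map_smul,
      map_smul, hSk, (isHermitian_occupiedOp k).eq, (isHermitian_emptyOp k).eq,
      occupiedOp_mul_self hk, occupiedOp_mul_self hk]
    exact re_trace_occupiedOp_superposition_le hρ hk
      ((S.norm_starProjection_apply_le w).trans hw.le) (inner_starProjection_eq_zero hS hkw) hαβ

/-- The majorization for `S` orthogonal to `k`: here the restricted single-particle density matrix
is exactly the average of those after the measurement. -/
theorem majorized_spdmOn_of_mem_orthogonal {ρ : FockOp n} (hρ : ρ.PosSemidef)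
    {k : EuclideanSpace ℂ (Fin n)} (hk : ‖k‖ = 1) {S : Submodule ℂ (EuclideanSpace ℂ (Fin n))}
    (hS : k ∈ Sᗮ) :
    Majorized (sortedSpectrum (spdmOn S ρ))
      (outcomeProb (occupiedOp k) ρ • sortedSpectrum (spdmOn S (postState (occupiedOp k) ρ)) +
        outcomeProb (emptyOp k) ρ • sortedSpectrum (spdmOn S (postState (emptyOp k) ρ))) := by
  have h (v : EuclideanSpace ℂ (Fin n)) := expVal_spdmOn_of_commute hρ hk S (v := v)
    (commute_occupiedOp_of_orthogonal
      (S.inner_left_of_mem_orthogonal (S.starProjection_apply_mem v) hS))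
  refine majorized_of_expVal (isHermitian_spdmOn S hρ.isHermitian)
    (outcomeProb_nonneg hρ _) (outcomeProb_nonneg hρ _) (EuclideanSpace.basisFun _ ℂ)
    (isHermitian_spdmOn S (isHermitian_postState _ hρ.isHermitian))
    (isHermitian_spdmOn S (isHermitian_postState _ hρ.isHermitian)) (fun i => h _)
    fun m _ v hv => ⟨v, v, hv, hv, le_of_eq ?_⟩
  simp only [h, Finset.sum_add_distrib, Finset.mul_sum]

theorem spdmOn_top (ρ : FockOp n) : spdmOn ⊤ ρ = spdm ρ := by
  have h : subspaceProj (⊤ : Submodule ℂ (EuclideanSpace ℂ (Fin n))) = 1 := by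
    apply Matrix.toEuclideanLin.injective
    ext1 v
    rw [toEuclideanLin_subspaceProj]
    rw [Submodule.starProjection_eq_self_iff.2 Submodule.mem_top]
    simp
  simp [spdmOn, h]

end FermionFock

open FermionFock
theorem theorem1 (n : ℕ) (k : EuclideanSpace ℂ (Fin n)) (hk : ‖k‖ = 1) :
    IsONG (krausMap (occupancyKraus k)) ∧
    IsNongeneratingFamily (occupancyKraus k) ∧
    (∀ ρ : FockOp n, IsDensity ρ →
      Majorized
        (sortedSpectrum (spdm ρ))
        (outcomeProb (occupiedOp k) ρ •
            sortedSpectrum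
              (spdm (postState (occupiedOp k) ρ)) +
          outcomeProb (emptyOp k) ρ •
            sortedSpectrum
              (spdm (postState (emptyOp k) ρ)))) ∧
    (∀ S : Submodule ℂ (EuclideanSpace ℂ (Fin n)), (k ∈ S ∨ k ∈ Sᗮ) →
      ∀ ρ : FockOp n, IsDensity ρ →
        Majorized
          (sortedSpectrum (spdmOn S ρ))
          (outcomeProb (occupiedOp k) ρ •
              sortedSpectrum
                (spdmOn S (postState (occupiedOp k) ρ)) +
            outcomeProb (emptyOp k) ρ •
              sortedSpectrum
                (spdmOn S (postState (emptyOp k) ρ)))) := by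
  have hmain (ρ : FockOp n) (hρ : IsDensity ρ) :=
    majorized_spdmOn_of_mem hρ.posSemidef hk (Submodule.mem_top (x := k))
  simp only [spdmOn_top] at hmain
  have hfam : IsNongeneratingFamily (occupancyKraus k) :=
    { complete := complete_occupancyKraus hk
      number_conserving := commute_occupancyKraus_numberOp hk
      majorized := fun ρ hρ => by
        rw [Fin.sum_univ_two]
        exact hmain ρ hρ }
  refine ⟨⟨2, occupancyKraus k, rfl, hfam⟩, hfam, hmain, fun S hS ρ hρ => ?_⟩
  exact hS.elim (majorized_spdmOn_of_mem hρ.posSemidef hk)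
    (majorized_spdmOn_of_mem_orthogonal hρ.posSemidef hk)
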